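/- A gyrogroup is a nonempty set $G$ with a binary operation $\oplus$ such that: (G1) there is a unique element $0\in G$ with $0\oplus a=a=a\oplus 0$ for all $a\in G$; (G2) for each $x\in G$ there is a unique $\ominus x\in G$ with $\ominus x\oplus x=0=x\oplus(\ominus x)$; (G3) for all $x,y\in G$ there is an automorphism $\operatorname{gyr}[x,y]$ of $(G,\oplus)$ such that $x\oplus(y\oplus z)=(x\oplus y)\oplus\operatorname{gyr}[x,y](z)$ for all $z\in G$; (G4) $\operatorname{gyr}[x\oplus y,y]=\operatorname{gyr}[x,y]$ for all $x,y\in G$. A topological gyrogroup is a gyrogroup with a topology for which $\oplus\colon G\times G\to G$ and $\ominus\colon G\to G$ are continuous. It is a strongly topological gyrogroup if there is a neighborhood base $\mathscr U$ at $0$ such that $\operatorname{gyr}[x,y](U)=U$ for every $U\in\mathscr U$ and all $x,y\in G$. A topological space $X$ has countable pseudocharacter if for every $x\in X$ there is a sequence $(U_n)_{n\in\mathbb N}$ of open subsets of $X$ with $\{x\}=\bigcap_{n}U_n$. A space is Dieudonné complete if it is Tychonoff (completely regular and $T_0$) and there is a complete uniformity on it that induces its topology. Corollary (Dieudonné completeness).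 Every $T_0$ strongly topological gyrogroup with countable pseudocharacter is Dieudonné complete. -/

import Mathlib

open scoped Topology

/-- A gyrogroup, written additively: `x + y` is `x ⊕ y` and `-x` is `⊖x`.  The operation is not
assumed associative or commutative.  `gyr x y` is the gyroautomorphism `gyr[x, y]`, which is
determined by the operation. The identity is unique automatically. -/
class Gyrogroup (G : Type*) extends AddZeroClass G, Neg G where
  gyr : G → G → (G ≃+ G)
  neg_add_self : ∀ x : G, -x + x = 0
  add_neg_self : ∀ x : G, x + -x = 0
  neg_unique : ∀ x y : G, y + x = 0 → x + y = 0 → y = -x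
  add_gyr : ∀ x y z : G, x + (y + z) = (x + y) + gyr x y z
  gyr_add_left : ∀ x y : G, gyr (x + y) y = gyr x y

/-- A topological gyrogroup: addition is jointly continuous and inversion is continuous. -/
class TopologicalGyrogroup (G : Type*) [TopologicalSpace G] [Gyrogroup G] : Prop
    extends ContinuousAdd G, ContinuousNeg G

/-- A strongly topological gyrogroup: a topological gyrogroup with a neighborhood base at `0`
each member of which is mapped onto itself by every gyroautomorphism. -/
class StronglyTopologicalGyrogroup (G : Type*) [TopologicalSpace G] [Gyrogroup G] : Prop
    extends TopologicalGyrogroup G where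
  exists_gyr_invariant_basis : ∃ 𝓤 : Set (Set G),
    (𝓤 ⊆ {U | U ∈ 𝓝 (0 : G)}) ∧ (∀ V ∈ 𝓝 (0 : G), ∃ U ∈ 𝓤, U ⊆ V) ∧
      ∀ U ∈ 𝓤, ∀ x y : G, Gyrogroup.gyr x y '' U = U

/-- Countable pseudocharacter: every point is the intersection of a sequence of open sets. -/
def HasCountablePseudocharacter (X : Type*) [TopologicalSpace X] : Prop :=
  ∀ x : X, ∃ U : ℕ → Set X, (∀ n, IsOpen (U n)) ∧ ({x} : Set X) = ⋂ n, U n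

/-- A Dieudonné complete space: a Tychonoff (completely regular `T₀`) space whose topology is
induced by some complete uniformity. -/
def IsDieudonneComplete (X : Type*) [t : TopologicalSpace X] : Prop :=
  T35Space X ∧ ∃ u : UniformSpace X, u.toTopologicalSpace = t ∧ @CompleteSpace X u

/-! Gyr-invariant neighborhoods `U` of `0` make the sets `-x + y ∈ U` entourages of a uniformity
inducing the topology, so `G` is Tychonoff. Countable pseudocharacter picks countably many
entourages meeting in the diagonal; they generate a coarser metrizable uniformity, so `G` injects
continuously into a metric space. Any such Tychonoff space is complete in its fine uniformity,
because a positive continuous function cannot tend to `0` along a fine Cauchy filter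
(`Cauchy.not_tendsto_zero_of_pos`). -/

open Filter Set Uniformity

namespace Gyrogroup

variable {G : Type*} [Gyrogroup G]

theorem add_left_injective (a : G) : Function.Injective (a + ·) := by
  intro b c h
  have h' : -a + (a + b) = -a + (a + c) := congrArg (-a + ·) h
  rw [add_gyr, add_gyr, neg_add_self, zero_add, zero_add] at h'
  exact (gyr (-a) a).injective h'

theorem gyr_zero_left (a b : G) : gyr 0 a b = b := by
  have h := add_gyr 0 a b
  rw [zero_add, zero_add] at h
  exact (add_left_injective a h).symm

/-- By (G4), `gyr (-a) a = gyr (-a + a) a = gyr 0 a`, the identity. -/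
theorem neg_add_cancel_left (a b : G) : -a + (a + b) = b := by
  rw [add_gyr, ← gyr_add_left, neg_add_self, gyr_zero_left, zero_add]

theorem add_neg_cancel_left (a b : G) : a + (-a + b) = b := by
  rw [add_gyr, ← gyr_add_left, add_neg_self, gyr_zero_left, zero_add]

theorem neg_zero_eq : -(0 : G) = 0 :=
  (neg_unique 0 0 (zero_add 0) (zero_add 0)).symm

theorem neg_add_eq_zero_iff {a b : G} : -a + b = 0 ↔ a = b := by
  refine ⟨fun h ↦ ?_, fun h ↦ h ▸ neg_add_self a⟩
  have := add_neg_cancel_left a b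
  rwa [h, add_zero] at this

/-- Gives the triangle inequality for entourages, since invariant neighborhoods absorb the gyration.
-/
theorem neg_add_add_gyr (a b c : G) : (-a + b) + gyr (-a) b (-b + c) = -a + c := by
  rw [← add_gyr, add_neg_cancel_left]

theorem gyr_neg_add (a b : G) : gyr (-a) b (-b + a) = -(-a + b) := by
  apply add_left_injective (-a + b)
  simp only [neg_add_add_gyr, neg_add_self, add_neg_self]

end Gyrogroup

namespace StronglyTopologicalGyrogroup

open Gyrogroup

variable (G : Type*) [TopologicalSpace G] [Gyrogroup G] [StronglyTopologicalGyrogroup G]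

variable {G} in
theorem exists_gyr_mem_iff {V : Set G} (hV : V ∈ 𝓝 0) :
    ∃ U ∈ 𝓝 (0 : G), U ⊆ V ∧ ∀ x y z : G, gyr x y z ∈ U ↔ z ∈ U := by
  obtain ⟨B, hB, hbasis, hgyr⟩ := exists_gyr_invariant_basis (G := G)
  obtain ⟨U, hU, hUV⟩ := hbasis V hV
  refine ⟨U, hB hU, hUV, fun x y z ↦ ?_⟩
  conv_lhs => rw [← hgyr U hU x y]
  exact (gyr x y).injective.mem_set_image

theorem nhds_eq_comap_neg_add (x : G) : 𝓝 x = comap (fun y ↦ -x + y) (𝓝 0) := by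
  let e : G ≃ₜ G :=
    { toFun := fun y ↦ -x + y
      invFun := fun y ↦ x + y
      left_inv := add_neg_cancel_left x
      right_inv := neg_add_cancel_left x
      continuous_toFun := continuous_const.add continuous_id
      continuous_invFun := continuous_const.add continuous_id }
  have h := e.isInducing.nhds_eq_comap x
  have hx : e x = 0 := neg_add_self x
  rwa [hx] at h

/-- The uniformity whose entourages are the sets containing `{(x, y) | -x + y ∈ U}` for some
neighborhood `U` of `0`. -/
abbrev leftUniformSpace : UniformSpace G where
  uniformity := comap (fun p : G × G ↦ -p.1 + p.2) (𝓝 0)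
  symm := by
    rw [tendsto_comap_iff]
    intro V hV
    obtain ⟨U, hU, hUV, hgyr⟩ := exists_gyr_mem_iff hV
    have hneg : {z : G | -z ∈ U} ∈ 𝓝 (0 : G) :=
      continuous_neg.continuousAt.preimage_mem_nhds (by rwa [neg_zero_eq])
    refine ⟨_, hneg, fun p hp ↦ hUV ?_⟩
    change -p.2 + p.1 ∈ U
    rw [← hgyr (-p.1) p.2, gyr_neg_add]
    exact hp
  comp := by
    intro S hS
    obtain ⟨V, hV, hVS⟩ := hS
    have hadd : {p : G × G | p.1 + p.2 ∈ V} ∈ 𝓝 (0 : G) ×ˢ 𝓝 (0 : G) := by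
      rw [← nhds_prod_eq]
      exact continuous_add.continuousAt.preimage_mem_nhds (by simpa using hV)
    obtain ⟨W, hW, hWV⟩ := mem_prod_same_iff.1 hadd
    obtain ⟨U, hU, hUW, hgyr⟩ := exists_gyr_mem_iff hW
    refine mem_of_superset (mem_lift' (preimage_mem_comap hU)) ?_
    rintro ⟨x, z⟩ ⟨y, hxy, hyz⟩
    apply hVS
    change -x + z ∈ V
    rw [← neg_add_add_gyr x y z]
    exact hWV (mk_mem_prod (hUW hxy) (hUW ((hgyr _ _ _).2 hyz)))
  nhds_eq_comap_uniformity x := by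
    rw [comap_comap, nhds_eq_comap_neg_add G x]
    rfl

end StronglyTopologicalGyrogroup

theorem UniformSpace.exists_isCountablyGenerated_ge {X : Type*} [u : UniformSpace X]
    (V : ℕ → Set (X × X)) (hV : ∀ n, V n ∈ 𝓤 X) :
    ∃ v : UniformSpace X, u ≤ v ∧ 𝓤[v].IsCountablyGenerated ∧ ∀ n, V n ∈ 𝓤[v] := by
  have step : ∀ S T : {S : SetRel X X // S ∈ 𝓤 X},
      ∃ R : {S : SetRel X X // S ∈ 𝓤 X}, SetRel.IsSymm R.1 ∧
        SetRel.comp R.1 R.1 ⊆ S.1 ∩ T.1 := by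
    rintro ⟨S, hS⟩ ⟨T, hT⟩
    obtain ⟨R, hR, hsymm, hcomp⟩ := comp_symm_mem_uniformity_sets (inter_mem hS hT)
    exact ⟨⟨R, hR⟩, hsymm, hcomp⟩
  choose next hsymm hcomp using step
  -- `W 0` is everything; the square of `W (n + 1)` lies in `W n ∩ V n`.
  let W : ℕ → {S : SetRel X X // S ∈ 𝓤 X} := fun n ↦
    Nat.rec ⟨univ, univ_mem⟩ (fun n S ↦ next S ⟨V n, hV n⟩) n
  have hWcomp : ∀ n, SetRel.comp (W (n + 1)).1 (W (n + 1)).1 ⊆ (W n).1 ∩ V n :=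
    fun n ↦ hcomp _ _
  have hWsub : ∀ n, (W (n + 1)).1 ⊆ (W n).1 ∩ V n := fun n p hp ↦
    hWcomp n ⟨p.1, refl_mem_uniformity (W (n + 1)).2, hp⟩
  have hanti : Antitone fun n ↦ (W n).1 :=
    antitone_nat_of_succ_le fun n ↦ (hWsub n).trans inter_subset_left
  let F : Filter (X × X) := ⨅ n, 𝓟 (W n).1
  have hbasis : F.HasBasis (fun _ : ℕ ↦ True) fun n ↦ (W n).1 :=
    hasBasis_iInf_principal hanti.directed_ge
  have hWF : ∀ n, (W n).1 ∈ F := fun n ↦ hbasis.mem_of_mem trivial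
  let c : UniformSpace.Core X :=
    { uniformity := F
      refl := hbasis.ge_iff.2 fun n _ ↦ by
        rintro ⟨x, y⟩ (rfl : x = y)
        exact refl_mem_uniformity (W n).2
      symm := (hbasis.tendsto_iff hbasis).2 fun n _ ↦ ⟨n + 1, trivial, fun p hp ↦
        (hWsub n ((hsymm (W n) ⟨V n, hV n⟩).symm _ _ hp)).1⟩
      comp := fun S hS ↦ by
        obtain ⟨n, -, hn⟩ := hbasis.mem_iff.1 hS
        exact mem_of_superset (mem_lift' (hWF (n + 1)))
          (((hWcomp n).trans inter_subset_left).trans hn) }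
  refine ⟨.ofCore c, ?_, ?_, fun n ↦ ?_⟩
  · exact hbasis.ge_iff.2 fun n _ ↦ (W n).2
  · exact hbasis.isCountablyGenerated
  · exact mem_of_superset (hWF (n + 1)) ((hWsub n).trans inter_subset_right)

/-- The finest uniformity whose topology is coarser than the given one. -/
abbrev fineUniformSpace (X : Type*) [t : TopologicalSpace X] : UniformSpace X :=
  sInf {u : UniformSpace X | t ≤ u.toTopologicalSpace}

theorem toTopologicalSpace_fineUniformSpace (X : Type*) [t : TopologicalSpace X]
    [CompletelyRegularSpace X] : (fineUniformSpace X).toTopologicalSpace = t := by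
  obtain ⟨u, hu⟩ := CompletelyRegularSpace.exists_uniformSpace (X := X)
  apply le_antisymm
  · rw [← hu]
    exact UniformSpace.toTopologicalSpace_mono (sInf_le (by simp))
  · rw [UniformSpace.toTopologicalSpace_sInf]
    exact le_iInf₂ fun _ h ↦ h

theorem Continuous.uniformContinuous_fineUniformSpace {X Y : Type*} [t : TopologicalSpace X]
    [UniformSpace Y] {f : X → Y} (hf : Continuous f) :
    @UniformContinuous X Y (fineUniformSpace X) _ f := by
  rw [uniformContinuous_iff_le_comap]
  exact sInf_le (continuous_iff_le_induced.1 hf)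

section FineCauchy

variable {X : Type*} [TopologicalSpace X] {F : Filter X}

theorem Cauchy.map_of_continuous {Y : Type*} [UniformSpace Y]
    (hF : @Cauchy X (fineUniformSpace X) F) {f : X → Y} (hf : Continuous f) :
    Cauchy (Filter.map f F) :=
  letI := fineUniformSpace X
  Cauchy.map hF hf.uniformContinuous_fineUniformSpace

/-- The continuous function `1 / h` also converges along `F`, so `h * (1 / h) = 1` would tend to
`0`. -/
theorem Cauchy.not_tendsto_zero_of_pos (hF : @Cauchy X (fineUniformSpace X) F) {h : X → ℝ}
    (hc : Continuous h) (hpos : ∀ x, 0 < h x) : ¬ Tendsto h F (𝓝 0) := by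
  intro h0
  have : F.NeBot := hF.1
  obtain ⟨c, hcF⟩ := CompleteSpace.complete
    (hF.map_of_continuous (hc.inv₀ fun x ↦ (hpos x).ne'))
  have h1 : Tendsto (fun x ↦ h x * (h x)⁻¹) F (𝓝 (0 * c)) := h0.mul hcF
  simp only [fun x ↦ mul_inv_cancel₀ (hpos x).ne', zero_mul] at h1
  exact one_ne_zero (tendsto_nhds_unique tendsto_const_nhds h1)

end FineCauchy

theorem isDieudonneComplete_of_continuous_injective {X M : Type*} [TopologicalSpace X]
    [T35Space X] [MetricSpace M] {f : X → M} (hf : Continuous f) (hinj : Function.Injective f) :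
    IsDieudonneComplete X := by
  have htop := toTopologicalSpace_fineUniformSpace X
  refine ⟨inferInstance, fineUniformSpace X, htop, ?_⟩
  refine @CompleteSpace.mk X (fineUniformSpace X) fun {F} hF ↦ ?_
  have hF0 : F.NeBot := hF.1
  let j : X → UniformSpace.Completion M := fun x ↦ (f x : UniformSpace.Completion M)
  have hj : Continuous j := (UniformSpace.Completion.continuous_coe M).comp hf
  obtain ⟨p, hp⟩ := CompleteSpace.complete (hF.map_of_continuous hj)
  have hdist : Tendsto (fun x ↦ dist (j x) p) F (𝓝 0) := tendsto_iff_dist_tendsto_zero.1 hp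
  have hdc : Continuous fun x ↦ dist (j x) p := hj.dist continuous_const
  obtain ⟨x₀, rfl⟩ : ∃ x, j x = p := by
    by_contra! hne
    exact hF.not_tendsto_zero_of_pos hdc (fun x ↦ dist_pos.2 (hne x)) hdist
  refine ⟨x₀, ?_⟩
  rw [htop]
  intro U hU
  obtain ⟨O, hOU, hO, hxO⟩ := mem_nhds_iff.1 hU
  obtain ⟨g, hg, hg0, hg1⟩ :=
    CompletelyRegularSpace.completely_regular x₀ Oᶜ hO.isClosed_compl (by simpa using hxO)
  have hg' : Continuous fun x ↦ (g x : ℝ) := continuous_subtype_val.comp hg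
  obtain ⟨c, hc⟩ := CompleteSpace.complete (hF.map_of_continuous hg')
  -- If `c ≠ 0`, the sum below is positive: at `x₀` by its second term, elsewhere by its first, as
  -- `f` is injective.
  obtain rfl : c = 0 := by
    by_contra hc0
    refine hF.not_tendsto_zero_of_pos (h := fun x ↦ dist (j x) (j x₀) + dist (g x : ℝ) c)
      (hdc.add (hg'.dist continuous_const)) (fun x ↦ ?_) ?_
    · rcases eq_or_ne x x₀ with rfl | hx
      · refine add_pos_of_nonneg_of_pos dist_nonneg (dist_pos.2 ?_)
        simpa [hg0] using Ne.symm hc0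
      · refine add_pos_of_pos_of_nonneg (dist_pos.2 fun h ↦ hx (hinj ?_)) dist_nonneg
        exact UniformSpace.Completion.coe_injective M h
    · simpa using hdist.add (tendsto_iff_dist_tendsto_zero.1 hc)
  have hlt : ∀ᶠ x in F, (g x : ℝ) < 1 := hc (Iio_mem_nhds one_pos)
  filter_upwards [hlt] with x hx
  by_contra hxU
  have : g x = 1 := hg1 fun h ↦ hxU (hOU h)
  simp [this] at hx

theorem StronglyTopologicalGyrogroup.exists_continuous_metricSpace (G : Type*)
    [t : TopologicalSpace G] [Gyrogroup G] [StronglyTopologicalGyrogroup G]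
    (hG : HasCountablePseudocharacter G) :
    ∃ m : MetricSpace G, t ≤ m.toUniformSpace.toTopologicalSpace := by
  let u := leftUniformSpace G
  obtain ⟨U, hUo, hU⟩ := hG 0
  have hU0 : ∀ n, U n ∈ 𝓝 (0 : G) := fun n ↦
    (hUo n).mem_nhds (mem_iInter.1 (hU ▸ mem_singleton (0 : G)) n)
  obtain ⟨v, huv, hcg, hv⟩ := UniformSpace.exists_isCountablyGenerated_ge
    (fun n ↦ {p : G × G | -p.1 + p.2 ∈ U n}) fun n ↦ preimage_mem_comap (hU0 n)
  have hT0 : @T0Space G v.toTopologicalSpace := by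
    refine (@t0Space_iff_uniformity G v).2 fun x y hxy ↦ ?_
    have h0 : -x + y ∈ ({0} : Set G) := by
      rw [hU]
      exact mem_iInter.2 fun n ↦ hxy _ (hv n)
    exact Gyrogroup.neg_add_eq_zero_iff.1 h0
  exact ⟨@UniformSpace.metricSpace G v hcg hT0, UniformSpace.toTopologicalSpace_mono huv⟩

theorem mainTheorem5 (G : Type*) [TopologicalSpace G] [T0Space G] [Gyrogroup G]
    [StronglyTopologicalGyrogroup G] (hG : HasCountablePseudocharacter G) :
    IsDieudonneComplete G := by
  have : CompletelyRegularSpace G := .of_exists_uniformSpace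
    ⟨StronglyTopologicalGyrogroup.leftUniformSpace G, rfl⟩
  have : T35Space G := {}
  obtain ⟨m, hm⟩ := StronglyTopologicalGyrogroup.exists_continuous_metricSpace G hG
  exact isDieudonneComplete_of_continuous_injective (M := G) (f := id)
    (continuous_id_iff_le.2 hm) Function.injective_id
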